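/- For positive integers $n,d$, let $T(n,d)$ be the number of functions $f:\{-1,1\}^n\to\{-1,1\}$ of the form $f(x)=\operatorname{sgn}(p(x))$, where $p$ is a real polynomial in $n$ variables of degree at most $d$ with no roots in $\{-1,1\}^n$. Write $\binom{n}{\le d}=\binom n0+\binom n1+\cdots+\binom nd$. Then: (i) there is an absolute constant $C>0$ such that for all integers $n\ge 2$ and $d$ with $1\le d\le n^{0.9}$, $$\max\Big(0,\,1-\frac{C}{\log n}\Big)^{d}\cdot n\binom{n}{\le d}\;\le\;\log_2 T(n,d);$$ (ii) for all integers $1\le d\le n$ (in particular whenever $1\le d\le n^{0.9}$), $$\log_2 T(n,d)\;\le\; n\binom{n}{\le d}.$$ -/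

import Mathlib

/-- `f : {-1,1}ⁿ → {-1,1}` is a polynomial threshold function of degree (at most) `d`:
`f x = sgn (p x)` on the cube for some real polynomial `p` in `n` variables of total degree
at most `d` having no roots in the cube. The two-element set `{-1,1}` is the type `ℤˣ`. -/
def IsPolyThreshold (n d : ℕ) (f : (Fin n → ℤˣ) → ℤˣ) : Prop :=
  ∃ p : MvPolynomial (Fin n) ℝ, p.totalDegree ≤ d ∧
    ∀ x : Fin n → ℤˣ,
      MvPolynomial.eval (fun i => ((x i : ℤ) : ℝ)) p ≠ 0 ∧
      ((f x : ℤ) : ℝ) = Real.sign (MvPolynomial.eval (fun i => ((x i : ℤ) : ℝ)) p)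

/-- The number `T(n,d)` of Boolean polynomial threshold functions of degree `d` on `{-1,1}ⁿ`. -/
noncomputable def numPolyThreshold (n d : ℕ) : ℕ :=
  Nat.card {f : (Fin n → ℤˣ) → ℤˣ // IsPolyThreshold n d f}

/-- The binomial sum `C(n,0) + C(n,1) + ⋯ + C(n,d)`. -/
def binomSum (n d : ℕ) : ℕ :=
  ∑ k ∈ Finset.range (d + 1), n.choose k

/-! Upper bound. Distinct multilinear monomials are distinct characters of the cube, so the
functions of degree at most `d` form a space of dimension D = `binomSum n d`. Its positivity sets
shatter no D + 1 points, and Sauer–Shelah (`card_posSets_le`) leaves at most ∑_{i ≤ D} C(2^n, i) ≤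
2^(nD) of them.

Lower bound. A central hyperplane arrangement has at least as many regions as flats
(`card_zeroPats_le_card_signPats`), so it suffices to produce many zero sets. Write n = m + r with r
of order n / log n, and let k = `binomSum m d`. A nonzero function of degree d on the m-cube has at
least 2^(m-d) nonzeros, which yields at least 2^((m-d)k) k-tuples of points with independent
evaluations. Different tuples may have the same zero closure; the r spare coordinates, filled with
random signs z, control this. If y lies in the closure of the extended tuple, its truncation v
satisfies f(v) = ∑ c_i f(u_i) with c determined by v, and every new coordinate forces ∑ c_i z_i =
±1. By Littlewood–Offord this is unlikely when c has at least 2s nonzero entries, and a union bound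
over v gives a z for which only sparse c survive (`exists_card_zeroClosure_le`). Sparse combinations
reach at most M = ((k+1)(m+1))^(2s) points, so each closure comes from at most M^k tuples
(`two_pow_le_mul_numPolyThreshold`). With s about n^0.05, both log M and the passage from n to m are
affordable. -/

/-! ### Sauer–Shelah and binomial sums -/

open Finset in
/-- A Sauer–Shelah bound: a space of functions of dimension at most `s` on `N` points cuts out
at most `∑ i ≤ s, N.choose i` sets of the form `{f > 0}`. -/
theorem card_posSets_le {X : Type*} [Fintype X] [DecidableEq X] (W : Submodule ℝ (X → ℝ))
    (s : ℕ) (hs : Module.finrank ℝ W ≤ s) (𝒜 : Finset (Finset X))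
    (h𝒜 : ∀ P ∈ 𝒜, ∃ f ∈ W, ∀ x, x ∈ P ↔ 0 < f x) :
    #𝒜 ≤ ∑ i ∈ range (s + 1), (Fintype.card X).choose i := by
  have key : ∀ B, 𝒜.Shatters B → #B ≤ s := by
    intro B hB
    by_contra! hlt
    let L : W →ₗ[ℝ] (B → ℝ) := (LinearMap.funLeft ℝ ℝ (Subtype.val : B → X)).comp W.subtype
    have hr : LinearMap.range L < ⊤ := by
      rw [lt_top_iff_ne_top]
      intro htop
      have h1 := LinearMap.finrank_range_le L
      rw [htop, finrank_top, Module.finrank_fintype_fun_eq_card, Fintype.card_coe] at h1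
      omega
    -- A nontrivial linear relation on `B` satisfied by all of `W`. A member of `W` positive exactly
    -- where the coefficients are positive would violate it.
    obtain ⟨φ, hφ0, hφ⟩ := Submodule.exists_le_ker_of_lt_top _ hr
    have hsum : ∀ ψ : (B → ℝ) →ₗ[ℝ] ℝ, LinearMap.range L ≤ LinearMap.ker ψ → ∀ f ∈ W,
        ∑ b : B, f b * ψ (Pi.single b 1) = 0 := by
      intro ψ hψ f hf
      have h1 : ψ (L ⟨f, hf⟩) = 0 := hψ ⟨_, rfl⟩
      rw [LinearMap.pi_apply_eq_sum_univ] at h1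
      have h2 : ∀ b : B, (fun j => if b = j then 1 else 0 : B → ℝ) = Pi.single b 1 := by
        intro b
        ext j
        simp [Pi.single_apply, eq_comm]
      simp only [h2] at h1
      simpa [L, LinearMap.funLeft, Function.comp_def] using h1
    have hpos : ∀ ψ : (B → ℝ) →ₗ[ℝ] ℝ, LinearMap.range L ≤ LinearMap.ker ψ →
        ∀ b, ¬ 0 < ψ (Pi.single b 1) := by
      intro ψ hψ b hb
      obtain ⟨P, hP, hPB⟩ := hB (t := (univ.filter fun b : B => 0 < ψ (Pi.single b 1)).map
        ⟨Subtype.val, Subtype.val_injective⟩) (by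
          intro x hx
          simp only [mem_map] at hx
          obtain ⟨y, -, rfl⟩ := hx
          exact y.2)
      obtain ⟨f, hf, hfP⟩ := h𝒜 P hP
      have hiff : ∀ b : B, 0 < f b ↔ 0 < ψ (Pi.single b 1) := by
        intro b
        have h2 := Finset.ext_iff.1 hPB b
        simp only [mem_inter, b.2, true_and, mem_map, mem_filter, mem_univ,
          Function.Embedding.coeFn_mk] at h2
        rw [← hfP, h2]
        constructor
        · rintro ⟨y, hy, hyb⟩
          rwa [← Subtype.ext hyb]
        · intro h
          exact ⟨b, h, rfl⟩
      refine (hsum ψ hψ f hf).not_gt (sum_pos' ?_ ⟨b, mem_univ _, mul_pos ((hiff b).2 hb) hb⟩)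
      intro c _
      by_cases hc : 0 < ψ (Pi.single c 1)
      · exact (mul_pos ((hiff c).2 hc) hc).le
      · exact mul_nonneg_of_nonpos_of_nonpos (not_lt.1 (mt (hiff c).1 hc)) (not_lt.1 hc)
    refine hφ0 (LinearMap.pi_ext' fun b => LinearMap.ext_ring ?_)
    have h1 := hpos φ hφ b
    -- Neither `φ` nor `-φ` has a positive coefficient, so `φ = 0`.
    have h2 := hpos (-φ) (by simpa using hφ) b
    simp only [LinearMap.neg_apply, Left.neg_pos_iff, not_lt] at h1 h2
    simpa using le_antisymm h1 h2
  refine (card_le_card_shatterer 𝒜).trans ((card_shatterer_le_sum_vcDim).trans ?_)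
  refine sum_le_sum_of_subset ?_
  intro i hi
  rw [mem_Iic] at hi
  rw [mem_range, Nat.lt_succ_iff]
  refine hi.trans (Finset.sup_le fun B hB => key B (mem_shatterer.1 hB))

theorem sum_range_choose_le_pow (N s : ℕ) :
    ∑ i ∈ Finset.range (s + 1), N.choose i ≤ (N + 1) ^ s := by
  rw [add_pow]
  refine Finset.sum_le_sum fun i hi => ?_
  rw [Finset.mem_range, Nat.lt_succ_iff] at hi
  simp only [one_pow, mul_one, Nat.cast_id]
  exact (Nat.choose_le_pow _ _).trans (Nat.le_mul_of_pos_right _ (Nat.choose_pos hi))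

/-- Having `N` rather than `N + 1` as base is what makes the upper bound exact, with N = 2^n. In the
induction, both the old sum and the new term are at most half of `N ^ (s + 1)`. The bound fails for
`s = 1`. -/
theorem sum_range_choose_le_pow_of_two_le (N s : ℕ) (hN : 2 ≤ N) (hs : 2 ≤ s) :
    ∑ i ∈ Finset.range (s + 1), N.choose i ≤ N ^ s := by
  induction s, hs using Nat.le_induction with
  | base =>
    obtain ⟨M, rfl⟩ := Nat.exists_eq_add_of_le hN
    simp only [Finset.sum_range_succ, Finset.sum_range_zero, Nat.choose_zero_right,
      Nat.choose_one_right, Nat.choose_two_right]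
    have : (2 + M) * (2 + M - 1) / 2 ≤ (2 + M) ^ 2 - (3 + M) := by
      apply Nat.div_le_of_le_mul
      have h1 : 2 + M - 1 = 1 + M := by omega
      rw [h1]
      zify [show 3 + M ≤ (2 + M) ^ 2 by nlinarith]
      nlinarith
    have h3 : 3 + M ≤ (2 + M) ^ 2 := by nlinarith
    omega
  | succ s hs ih =>
    rw [Finset.sum_range_succ]
    have h1 : 2 * N.choose (s + 1) ≤ N ^ (s + 1) := by
      have h2 := Nat.choose_le_pow_div (α := ℚ) (s + 1) N
      rw [le_div_iff₀ (by positivity)] at h2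
      have h3 : (2 : ℚ) ≤ ((s + 1).factorial : ℚ) := by
        exact_mod_cast (show 2 ≤ (s + 1).factorial from
          (Nat.self_le_factorial 2).trans (Nat.factorial_le (by omega)))
      have h4 : (2 : ℚ) * N.choose (s + 1) ≤ N ^ (s + 1) := by
        refine le_trans ?_ h2
        rw [mul_comm]
        gcongr
      exact_mod_cast h4
    have h5 : 2 * N ^ s ≤ N ^ (s + 1) := by
      rw [pow_succ, mul_comm]
      gcongr
    omega

/-! ### Zero patterns versus generic sign patterns -/

section ZeroPatterns
variable {X : Type*}

/-- `f` is generic in `V` on `S` if it vanishes at a point of `S` only when all of `V` does. -/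
def IsGenericOn (V : Submodule ℝ (X → ℝ)) (S : Finset X) (f : X → ℝ) : Prop :=
  ∀ s ∈ S, f s = 0 → ∀ g ∈ V, g s = 0

/-- A small perturbation of `f` keeps the signs of `f` off its zero set. -/
theorem exists_perturbation (S : Finset X) (f g : X → ℝ) :
    ∃ ε : ℝ, 0 < ε ∧ ∀ s ∈ S, f s ≠ 0 →
      (f s + ε * g s ≠ 0 ∧ (0 < f s + ε * g s ↔ 0 < f s) ∧
        f s - ε * g s ≠ 0 ∧ (0 < f s - ε * g s ↔ 0 < f s)) := by
  classical
  have hloc : ∀ s, f s ≠ 0 → ∃ δ : ℝ, 0 < δ ∧ ∀ ε, 0 < ε → ε ≤ δ → ε * |g s| < |f s| := by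
    intro s hs
    refine ⟨|f s| / (|g s| + 1), by positivity, fun ε hε h => ?_⟩
    rw [le_div_iff₀ (by positivity)] at h
    linarith
  have hunif : ∃ ε : ℝ, 0 < ε ∧ ∀ s ∈ S, f s ≠ 0 → ε * |g s| < |f s| := by
    have : ∃ δ : ℝ, 0 < δ ∧ ∀ s ∈ S, f s ≠ 0 → ∀ ε, 0 < ε → ε ≤ δ → ε * |g s| < |f s| := by
      induction S using Finset.induction_on with
      | empty => exact ⟨1, one_pos, by simp⟩
      | insert x S hx ih =>
        obtain ⟨δ, hδ, h⟩ := ih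
        by_cases hfx : f x = 0
        · refine ⟨δ, hδ, fun s hs hfs => ?_⟩
          rcases Finset.mem_insert.1 hs with rfl | hs
          · exact absurd hfx hfs
          · exact h s hs hfs
        · obtain ⟨δ', hδ', h'⟩ := hloc x hfx
          refine ⟨min δ δ', lt_min hδ hδ', fun s hs hfs ε hε hle => ?_⟩
          rcases Finset.mem_insert.1 hs with rfl | hs
          · exact h' ε hε (hle.trans (min_le_right _ _))
          · exact h s hs hfs ε hε (hle.trans (min_le_left _ _))
    obtain ⟨δ, hδ, h⟩ := this
    exact ⟨δ, hδ, fun s hs hfs => h s hs hfs δ hδ le_rfl⟩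
  obtain ⟨ε, hε, h⟩ := hunif
  refine ⟨ε, hε, fun s hs hfs => ?_⟩
  have h1 := h s hs hfs
  rw [← abs_of_pos hε, ← abs_mul] at h1
  generalize ε * g s = a at h1
  rw [abs_lt] at h1
  rcases lt_or_gt_of_ne hfs with h2 | h2
  · rw [abs_of_neg h2] at h1
    refine ⟨by linarith, ?_, by linarith, ?_⟩ <;> constructor <;> intro <;> linarith
  · rw [abs_of_pos h2] at h1
    refine ⟨by linarith, ?_, by linarith, ?_⟩ <;> constructor <;> intro <;> linarith

/-- Perturbing `f ∈ V` by `g ∈ V` preserves genericity and signs on `S`. -/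
theorem IsGenericOn.perturb {V : Submodule ℝ (X → ℝ)} {S : Finset X} {f : X → ℝ}
    (hf : IsGenericOn V S f) {g : X → ℝ} (hg : g ∈ V) :
    ∃ ε : ℝ, 0 < ε ∧ IsGenericOn V S (f + ε • g) ∧ IsGenericOn V S (f - ε • g) ∧
      ∀ s ∈ S, (0 < (f + ε • g) s ↔ 0 < f s) ∧ (0 < (f - ε • g) s ↔ 0 < f s) := by
  obtain ⟨ε, hε, h⟩ := exists_perturbation S f g
  refine ⟨ε, hε, fun s hs h0 => ?_, fun s hs h0 => ?_, fun s hs => ?_⟩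
  · refine hf s hs (by_contra fun hne => (h s hs hne).1 h0)
  · refine hf s hs (by_contra fun hne => (h s hs hne).2.2.1 h0)
  · by_cases h0 : f s = 0
    · simp [h0, hf s hs h0 g hg]
    · exact ⟨(h s hs h0).2.1, (h s hs h0).2.2.2⟩

/-- Signs of a generic function on `S` can be extended to a generic function on `insert x S`. -/
theorem IsGenericOn.exists_insert [DecidableEq X] {V : Submodule ℝ (X → ℝ)} {S : Finset X}
    {f : X → ℝ} (hfV : f ∈ V) (hf : IsGenericOn V S f) (x : X) :
    ∃ f' ∈ V, IsGenericOn V (insert x S) f' ∧ ∀ s ∈ S, (0 < f' s ↔ 0 < f s) := by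
  by_cases h : IsGenericOn V (insert x S) f
  · exact ⟨f, hfV, h, fun _ _ => Iff.rfl⟩
  have hx : f x = 0 ∧ ∃ g ∈ V, g x ≠ 0 := by
    by_contra! hx
    refine h fun s hs h0 => ?_
    rcases Finset.mem_insert.1 hs with rfl | hs
    · exact hx h0
    · exact hf s hs h0
  obtain ⟨hfx, g, hgV, hgx⟩ := hx
  obtain ⟨ε, hε, h1, -, h2⟩ := hf.perturb hgV
  refine ⟨f + ε • g, V.add_mem hfV (V.smul_mem _ hgV), fun s hs h0 => ?_, fun s hs => (h2 s hs).1⟩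
  rcases Finset.mem_insert.1 hs with rfl | hs
  · simp [hfx, hε.ne', hgx] at h0
  · exact h1 s hs h0

theorem exists_isGenericOn (V : Submodule ℝ (X → ℝ)) (S : Finset X) :
    ∃ f ∈ V, IsGenericOn V S f := by
  classical
  induction S using Finset.induction_on with
  | empty => exact ⟨0, V.zero_mem, by simp [IsGenericOn]⟩
  | insert x S _ ih =>
    obtain ⟨f, hfV, hf⟩ := ih
    obtain ⟨f', hf', h, -⟩ := hf.exists_insert hfV x
    exact ⟨f', hf', h⟩

open Classical in
/-- The zero sets on `S` of the functions in `V`. -/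
noncomputable def zeroPats (V : Submodule ℝ (X → ℝ)) (S : Finset X) : Finset (Finset X) :=
  S.powerset.filter fun P => ∃ f ∈ V, ∀ s ∈ S, s ∈ P ↔ f s = 0

open Classical in
/-- The positivity sets on `S` of the generic functions in `V`. -/
noncomputable def signPats (V : Submodule ℝ (X → ℝ)) (S : Finset X) : Finset (Finset X) :=
  S.powerset.filter fun P => ∃ f ∈ V, IsGenericOn V S f ∧ ∀ s ∈ S, s ∈ P ↔ 0 < f s

theorem mem_zeroPats {V : Submodule ℝ (X → ℝ)} {S P : Finset X} :
    P ∈ zeroPats V S ↔ P ⊆ S ∧ ∃ f ∈ V, ∀ s ∈ S, s ∈ P ↔ f s = 0 := by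
  simp [zeroPats]

theorem mem_signPats {V : Submodule ℝ (X → ℝ)} {S P : Finset X} :
    P ∈ signPats V S ↔ P ⊆ S ∧ ∃ f ∈ V, IsGenericOn V S f ∧ ∀ s ∈ S, s ∈ P ↔ 0 < f s := by
  simp [signPats]

/-- The functions in `V` vanishing at `x`. -/
def vanishAt (V : Submodule ℝ (X → ℝ)) (x : X) : Submodule ℝ (X → ℝ) :=
  V ⊓ LinearMap.ker (LinearMap.proj x : (X → ℝ) →ₗ[ℝ] ℝ)

theorem mem_vanishAt {V : Submodule ℝ (X → ℝ)} {x : X} {f : X → ℝ} :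
    f ∈ vanishAt V x ↔ f ∈ V ∧ f x = 0 := by
  simp [vanishAt]

variable [DecidableEq X]

/-- When the pattern on `S` decides vanishing at `x`, restriction of patterns to `S` is injective.
-/
theorem card_zeroPats_insert_le_of_vanish {V : Submodule ℝ (X → ℝ)} {S : Finset X} {x : X}
    (h : ∀ f ∈ V, ∀ g ∈ V, (∀ s ∈ S, f s = 0 ↔ g s = 0) → f x = 0 → g x = 0) :
    (zeroPats V (insert x S)).card ≤ (zeroPats V S).card := by
  refine Finset.card_le_card_of_injOn (fun P => P ∩ S) ?_ ?_
  · intro P hP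
    obtain ⟨-, f, hf, hfP⟩ := mem_zeroPats.1 hP
    refine mem_zeroPats.2 ⟨Finset.inter_subset_right, f, hf, fun s hs => ?_⟩
    rw [← hfP s (Finset.mem_insert_of_mem hs)]
    simp [hs]
  · intro P hP Q hQ hPQ
    obtain ⟨hPs, f, hf, hfP⟩ := mem_zeroPats.1 hP
    obtain ⟨hQs, g, hg, hgQ⟩ := mem_zeroPats.1 hQ
    have hS : ∀ s ∈ S, (s ∈ P ↔ s ∈ Q) := by
      intro s hs
      have := Finset.ext_iff.1 hPQ s
      simpa [hs] using this
    have hS' : ∀ s ∈ S, (f s = 0 ↔ g s = 0) := by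
      intro s hs
      rw [← hfP s (Finset.mem_insert_of_mem hs), ← hgQ s (Finset.mem_insert_of_mem hs), hS s hs]
    have hx : x ∈ P ↔ x ∈ Q := by
      rw [hfP x (Finset.mem_insert_self _ _), hgQ x (Finset.mem_insert_self _ _)]
      exact ⟨h f hf g hg hS', h g hg f hf fun s hs => (hS' s hs).symm⟩
    ext s
    by_cases hs : s ∈ insert x S
    · rcases Finset.mem_insert.1 hs with rfl | hs
      · exact hx
      · exact hS s hs
    · exact ⟨fun h => absurd (hPs h) hs, fun h => absurd (hQs h) hs⟩

theorem signPats_subset_image (V : Submodule ℝ (X → ℝ)) (S : Finset X) (x : X) :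
    signPats V S ⊆ (signPats V (insert x S)).image (fun P => P ∩ S) := by
  intro P hP
  obtain ⟨hPs, f, hf, hgen, hfP⟩ := mem_signPats.1 hP
  obtain ⟨f', hf', hgen', h⟩ := hgen.exists_insert hf x
  classical
  refine Finset.mem_image.2 ⟨(insert x S).filter fun s => 0 < f' s, mem_signPats.2
    ⟨Finset.filter_subset _ _, f', hf', hgen', fun s hs => by simp only [Finset.mem_filter, hs, true_and]⟩, ?_⟩
  ext s
  simp only [Finset.mem_inter, Finset.mem_filter]
  constructor
  · rintro ⟨⟨-, h1⟩, hs⟩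
    exact (hfP s hs).2 ((h s hs).1 h1)
  · intro hs
    exact ⟨⟨Finset.mem_insert_of_mem (hPs hs), (h s (hPs hs)).2 ((hfP s (hPs hs)).1 hs)⟩, hPs hs⟩

/-- Deletion–restriction for flats: patterns containing `x` come from `vanishAt V x`, the others
from `V` on `S`. -/
theorem card_zeroPats_insert_le_add (V : Submodule ℝ (X → ℝ)) {S : Finset X} {x : X}
    (hx : x ∉ S) :
    (zeroPats V (insert x S)).card ≤ (zeroPats V S).card + (zeroPats (vanishAt V x) S).card := by
  rw [← Finset.card_memberSubfamily_add_card_nonMemberSubfamily x (zeroPats V (insert x S)),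
    add_comm]
  gcongr
  · intro P hP
    obtain ⟨hP, hxP⟩ := Finset.mem_nonMemberSubfamily.1 hP
    obtain ⟨hPs, f, hf, h⟩ := mem_zeroPats.1 hP
    exact mem_zeroPats.2 ⟨(Finset.subset_insert_iff_of_notMem hxP).1 hPs, f, hf,
      fun s hs => h s (Finset.mem_insert_of_mem hs)⟩
  · intro P hP
    obtain ⟨hP, hxP⟩ := Finset.mem_memberSubfamily.1 hP
    obtain ⟨hPs, f, hf, h⟩ := mem_zeroPats.1 hP
    refine mem_zeroPats.2 ⟨(Finset.insert_subset_insert_iff hxP).1 hPs, f, mem_vanishAt.2 ⟨hf,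
      (h x (Finset.mem_insert_self _ _)).1 (Finset.mem_insert_self _ _)⟩, fun s hs => ?_⟩
    rw [← h s (Finset.mem_insert_of_mem hs), Finset.mem_insert]
    have : s ≠ x := ne_of_mem_of_not_mem hs hx
    simp [this]

/-- Deletion–restriction for regions: every pattern on `S` extends to `x`, and one realised by a
generic `f` vanishing at `x` extends both ways, through `f ± ε g`. Hypothesis `h` excludes points of
`S` parallel to `x`, so that genericity in `vanishAt V x` implies genericity in `V`. -/
theorem card_signPats_insert_ge_add {V : Submodule ℝ (X → ℝ)} {S : Finset X} {x : X}
    (hx : x ∉ S) {g : X → ℝ} (hgV : g ∈ V) (hgx : 0 < g x)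
    (h : ∀ s ∈ S, (∀ f ∈ vanishAt V x, f s = 0) → ∀ f ∈ V, f s = 0) :
    (signPats V S).card + (signPats (vanishAt V x) S).card ≤ (signPats V (insert x S)).card := by
  rw [← Finset.card_memberSubfamily_add_card_nonMemberSubfamily x (signPats V (insert x S)),
    ← Finset.card_union_add_card_inter (Finset.memberSubfamily x _)]
  gcongr
  · intro P hP
    obtain ⟨Q, hQ, rfl⟩ := Finset.mem_image.1 (signPats_subset_image V S x hP)
    obtain ⟨hQs, -⟩ := mem_signPats.1 hQ
    rw [Finset.mem_union, Finset.mem_memberSubfamily, Finset.mem_nonMemberSubfamily]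
    by_cases hxQ : x ∈ Q
    · left
      refine ⟨?_, by simp [hx]⟩
      convert hQ using 1
      ext s
      have := @hQs s
      simp only [Finset.mem_insert] at this
      simp only [Finset.mem_insert, Finset.mem_inter]
      constructor
      · rintro (rfl | h)
        exacts [hxQ, h.1]
      · intro hs
        rcases this hs with h | h
        exacts [.inl h, .inr ⟨hs, h⟩]
    · right
      refine ⟨?_, by simp [hx]⟩
      rwa [Finset.inter_eq_left.2 ((Finset.subset_insert_iff_of_notMem hxQ).1 hQs)]
  · intro P hP
    obtain ⟨hPs, f, hf, hgen, hfP⟩ := mem_signPats.1 hP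
    obtain ⟨hfV, hfx⟩ := mem_vanishAt.1 hf
    have hgen' : IsGenericOn V S f := fun s hs h0 => h s hs (hgen s hs h0)
    obtain ⟨ε, hε, h1, h2, h3⟩ := hgen'.perturb hgV
    have hxP : x ∉ P := fun h => hx (hPs h)
    rw [Finset.mem_inter, Finset.mem_memberSubfamily, Finset.mem_nonMemberSubfamily]
    refine ⟨⟨mem_signPats.2 ⟨Finset.insert_subset_insert _ hPs, f + ε • g,
      V.add_mem hfV (V.smul_mem _ hgV), fun s hs h0 => ?_, fun s hs => ?_⟩, hxP⟩,
      mem_signPats.2 ⟨hPs.trans (Finset.subset_insert _ _), f - ε • g,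
      V.sub_mem hfV (V.smul_mem _ hgV), fun s hs h0 => ?_, fun s hs => ?_⟩, hxP⟩
    · rcases Finset.mem_insert.1 hs with rfl | hs
      · simp [hfx, hε.ne', hgx.ne'] at h0
      · exact h1 s hs h0
    · rcases Finset.mem_insert.1 hs with rfl | hs
      · simp [hfx, hε, hgx]
      · have : s ≠ x := ne_of_mem_of_not_mem hs hx
        rw [(h3 s hs).1, ← hfP s hs, Finset.mem_insert]
        simp [this]
    · rcases Finset.mem_insert.1 hs with rfl | hs
      · simp [hfx, hε.ne', hgx.ne'] at h0
      · exact h2 s hs h0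
    · rcases Finset.mem_insert.1 hs with rfl | hs
      · have := mul_pos hε hgx
        simp only [hxP, false_iff, Pi.sub_apply, hfx, Pi.smul_apply, smul_eq_mul]
        linarith
      · rw [(h3 s hs).2, ← hfP s hs]

/-- A space of functions has at most as many zero patterns as generic sign patterns. -/
theorem card_zeroPats_le_card_signPats (V : Submodule ℝ (X → ℝ)) (S : Finset X) :
    (zeroPats V S).card ≤ (signPats V S).card := by
  induction S using Finset.induction_on generalizing V with
  | empty =>
    refine Finset.card_le_card fun P hP => ?_
    obtain ⟨hP, f, hf, -⟩ := mem_zeroPats.1 hP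
    exact mem_signPats.2 ⟨hP, f, hf, by simp [IsGenericOn], by simp⟩
  | insert x S hx ih =>
    have hmono : (signPats V S).card ≤ (signPats V (insert x S)).card :=
      (Finset.card_le_card (signPats_subset_image V S x)).trans Finset.card_image_le
    by_cases hV : ∀ f ∈ V, f x = 0
    · exact (card_zeroPats_insert_le_of_vanish fun f _ g hg _ _ => hV g hg).trans
        ((ih V).trans hmono)
    -- Here evaluation at `s` is a nonzero multiple of evaluation at `x`, so `x` adds no new zero
    -- pattern.
    by_cases hpar : ∃ s ∈ S, (∀ f ∈ vanishAt V x, f s = 0) ∧ ∃ f ∈ V, f s ≠ 0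
    · obtain ⟨s, hs, hvan, w, hwV, hws⟩ := hpar
      refine (card_zeroPats_insert_le_of_vanish fun f hf g hg hfg hfx => ?_).trans
        ((ih V).trans hmono)
      have hgs : g s = 0 := (hfg s hs).1 (hvan f (mem_vanishAt.2 ⟨hf, hfx⟩))
      by_contra hgx
      have := hvan (w - (w x / g x) • g) (mem_vanishAt.2
        ⟨V.sub_mem hwV (V.smul_mem _ hg), by simp [hgx]⟩)
      simp [hgs, hws] at this
    · push Not at hV hpar
      obtain ⟨g, hgV, hgx⟩ := hV
      obtain ⟨g, hgV, hgx⟩ : ∃ g ∈ V, 0 < g x := by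
        rcases lt_or_gt_of_ne hgx with h | h
        · exact ⟨-g, V.neg_mem hgV, by simpa using h⟩
        · exact ⟨g, hgV, h⟩
      calc _ ≤ _ := card_zeroPats_insert_le_add V hx
        _ ≤ _ := Nat.add_le_add (ih V) (ih _)
        _ ≤ _ := card_signPats_insert_ge_add hx hgV hgx hpar

end ZeroPatterns

/-! ### Low-degree functions on the cube -/

section PolySpace

/-- Functions on the cube `{-1,1}ⁿ` given by real polynomials of degree at most `d`. -/
def polySpace (n d : ℕ) : Submodule ℝ ((Fin n → ℤˣ) → ℝ) where
  carrier := {f | ∃ p : MvPolynomial (Fin n) ℝ, p.totalDegree ≤ d ∧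
    ∀ x, f x = MvPolynomial.eval (fun i => ((x i : ℤ) : ℝ)) p}
  add_mem' := by
    rintro f g ⟨p, hp, hf⟩ ⟨q, hq, hg⟩
    exact ⟨p + q, (MvPolynomial.totalDegree_add p q).trans (max_le hp hq), fun x => by
      simp [hf, hg]⟩
  zero_mem' := ⟨0, by simp, by simp⟩
  smul_mem' := by
    rintro c f ⟨p, hp, hf⟩
    exact ⟨c • p, (MvPolynomial.totalDegree_smul_le c p).trans hp, fun x => by
      simp [hf, MvPolynomial.smul_eval]⟩

theorem one_mem_polySpace (n d : ℕ) : (1 : (Fin n → ℤˣ) → ℝ) ∈ polySpace n d :=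
  ⟨1, by simp, by simp⟩

/-- The multilinear monomial `∏ i ∈ A, x i` as a character of the cube. -/
def parityChar {n : ℕ} (A : Finset (Fin n)) : (Fin n → ℤˣ) →* ℝ where
  toFun x := ∏ i ∈ A, ((x i : ℤ) : ℝ)
  map_one' := by simp
  map_mul' x y := by simp [Finset.prod_mul_distrib]

theorem parityChar_apply {n : ℕ} (A : Finset (Fin n)) (x : Fin n → ℤˣ) :
    parityChar A x = ∏ i ∈ A, ((x i : ℤ) : ℝ) := rfl

theorem parityChar_mul_self {n : ℕ} (A : Finset (Fin n)) (x : Fin n → ℤˣ) :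
    parityChar A x * parityChar A x = 1 := by
  rw [← map_mul]
  have : x * x = 1 := by
    ext i
    simp
  rw [this, map_one]

theorem parityChar_update {n : ℕ} (A : Finset (Fin n)) (i : Fin n) :
    parityChar A (Function.update 1 i (-1)) = if i ∈ A then -1 else 1 := by
  rw [parityChar_apply, ← Finset.prod_ite_eq A i (fun _ => (-1 : ℝ))]
  refine Finset.prod_congr rfl fun j _ => ?_
  by_cases h : j = i
  · subst h; simp
  · simp [h, Ne.symm h]

theorem parityChar_injective {n : ℕ} :
    Function.Injective (parityChar : Finset (Fin n) → ((Fin n → ℤˣ) →* ℝ)) := by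
  intro A B h
  ext i
  have := DFunLike.congr_fun h (Function.update (1 : Fin n → ℤˣ) i (-1))
  rw [parityChar_update, parityChar_update] at this
  by_cases hA : i ∈ A <;> by_cases hB : i ∈ B <;> simp [hA, hB] at this ⊢ <;> norm_num at this

theorem parityChar_mem_polySpace {n d : ℕ} (A : Finset (Fin n)) (hA : A.card ≤ d) :
    (parityChar A : (Fin n → ℤˣ) → ℝ) ∈ polySpace n d := by
  refine ⟨∏ i ∈ A, MvPolynomial.X i, ?_, fun x => by simp [parityChar_apply]⟩
  refine (MvPolynomial.totalDegree_finsetProd _ _).trans ?_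
  simpa [MvPolynomial.totalDegree_X] using hA

/-- On the cube x_i² = 1, so exponents reduce modulo 2 and every monomial becomes a character. -/
theorem polySpace_eq_span (n d : ℕ) :
    polySpace n d = Submodule.span ℝ (Set.range
      fun A : {A : Finset (Fin n) // A.card ≤ d} => (parityChar A.1 : (Fin n → ℤˣ) → ℝ)) := by
  refine le_antisymm ?_ (Submodule.span_le.2 ?_)
  · rintro f ⟨p, hp, hf⟩
    have : f = ∑ s ∈ p.support, p.coeff s •
        (parityChar (s.support.filter fun i => Odd (s i)) : (Fin n → ℤˣ) → ℝ) := by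
      ext x
      rw [hf, MvPolynomial.eval_eq, Finset.sum_apply]
      refine Finset.sum_congr rfl fun s _ => ?_
      rw [Pi.smul_apply, smul_eq_mul, parityChar_apply, Finset.prod_filter]
      congr 1
      refine Finset.prod_congr rfl fun i _ => ?_
      split_ifs with h
      · rcases Int.units_eq_one_or (x i) with hx | hx <;> simp [hx, h.neg_one_pow]
      · rw [Nat.not_odd_iff_even] at h
        rcases Int.units_eq_one_or (x i) with hx | hx <;> simp [hx, h.neg_one_pow]
    rw [this]
    refine Submodule.sum_mem _ fun s hs => Submodule.smul_mem _ _ (Submodule.subset_span ?_)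
    refine ⟨⟨s.support.filter fun i => Odd (s i), ?_⟩, rfl⟩
    refine (Finset.card_filter_le _ _).trans (le_trans ?_ ((MvPolynomial.le_totalDegree hs).trans hp))
    rw [Finsupp.sum, Finset.card_eq_sum_ones]
    exact Finset.sum_le_sum fun i hi => Nat.one_le_iff_ne_zero.2 (Finsupp.mem_support_iff.1 hi)
  · rintro _ ⟨A, rfl⟩
    exact parityChar_mem_polySpace A.1 A.2

theorem card_subtype_card_le (n d : ℕ) :
    Fintype.card {A : Finset (Fin n) // A.card ≤ d} = binomSum n d := by
  rw [Fintype.card_subtype, binomSum, Finset.card_eq_sum_card_fiberwise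
    (f := Finset.card) (t := Finset.range (d + 1))]
  · refine Finset.sum_congr rfl fun k hk => ?_
    rw [Finset.mem_range] at hk
    have h := Finset.card_powersetCard k (Finset.univ : Finset (Fin n))
    rw [Finset.card_univ, Fintype.card_fin] at h
    rw [← h]
    congr 1
    ext A
    simp only [Finset.mem_filter, Finset.mem_univ, true_and, Finset.mem_powersetCard,
      Finset.subset_univ]
    omega
  · intro A hA
    simpa [Nat.lt_succ_iff] using hA

theorem finrank_polySpace (n d : ℕ) : Module.finrank ℝ (polySpace n d) = binomSum n d := by
  rw [polySpace_eq_span, finrank_span_eq_card, card_subtype_card_le]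
  exact (linearIndependent_monoidHom (Fin n → ℤˣ) ℝ).comp
    (fun A : {A : Finset (Fin n) // A.card ≤ d} => parityChar A.1)
    (parityChar_injective.comp Subtype.val_injective)

/-- Flipping a coordinate in `A \ B` preserves the subcube and negates each term. -/
theorem sum_parityChar_mul_eq_zero {n : ℕ} {A B : Finset (Fin n)} (h : ¬ A ⊆ B)
    (x : Fin n → ℤˣ) :
    ∑ y : Fin n → ℤˣ with ∀ i ∉ A, y i = 1, parityChar B (x * y) * parityChar A (x * y) = 0 := by
  obtain ⟨i, hiA, hiB⟩ := Finset.not_subset.1 h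
  have hneg : ∑ y : Fin n → ℤˣ with ∀ i ∉ A, y i = 1,
      parityChar B (x * y) * parityChar A (x * y) =
      ∑ y : Fin n → ℤˣ with ∀ i ∉ A, y i = 1,
        -(parityChar B (x * y) * parityChar A (x * y)) := by
    refine Finset.sum_equiv (Equiv.mulRight (Function.update 1 i (-1))) ?_ ?_
    · intro y
      simp only [Finset.mem_filter, Finset.mem_univ, true_and, Equiv.coe_mulRight, Pi.mul_apply]
      refine forall₂_congr fun j hj => ?_
      have : j ≠ i := by rintro rfl; exact hj hiA
      simp [this]
    · intro y _
      simp only [Equiv.coe_mulRight, ← mul_assoc, map_mul, parityChar_update, hiA, hiB, if_true,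
        if_false]
      ring
  rw [Finset.sum_neg_distrib] at hneg
  linarith

/-- A nonzero function of degree at most `d` on the `n`-cube has at least `2^(n-d)` nonzeros. -/
theorem card_nonzeros_ge {n d : ℕ} {f : (Fin n → ℤˣ) → ℝ} (hf : f ∈ polySpace n d) (h0 : f ≠ 0) :
    2 ^ (n - d) ≤ (Finset.univ.filter fun x => f x ≠ 0).card := by
  rw [polySpace_eq_span, Submodule.mem_span_range_iff_exists_fun] at hf
  obtain ⟨a, ha⟩ := hf
  have hfx : ∀ x, f x = ∑ B, a B * parityChar B.1 x := by
    intro x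
    rw [← ha]
    simp
  have hne : (Finset.univ.filter fun B => a B ≠ 0).Nonempty := by
    by_contra hne
    rw [Finset.not_nonempty_iff_eq_empty, Finset.filter_eq_empty_iff] at hne
    refine h0 (funext fun x => ?_)
    rw [hfx]
    exact Finset.sum_eq_zero fun B hB => by simp [not_not.1 (hne hB)]
  -- On a subcube where only the coordinates in `A` vary, correlation with the character of `A`
  -- kills every `B` not containing `A`; maximality leaves `A` alone. So `f` is nonzero somewhere on
  -- each of the 2^(n-|A|) disjoint subcubes.
  obtain ⟨A, hA, hmax⟩ := Finset.exists_max_image _ (fun B => B.1.card) hne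
  rw [Finset.mem_filter] at hA
  have hex : ∀ x : Fin n → ℤˣ, ∃ y : Fin n → ℤˣ, (∀ i ∉ A.1, y i = 1) ∧ f (x * y) ≠ 0 := by
    intro x
    by_contra! hcon
    have h1 : ∑ y : Fin n → ℤˣ with ∀ i ∉ A.1, y i = 1, f (x * y) * parityChar A.1 (x * y) = 0 :=
      Finset.sum_eq_zero fun y hy => by rw [hcon y (Finset.mem_filter.1 hy).2, zero_mul]
    simp only [hfx, Finset.sum_mul] at h1
    rw [Finset.sum_comm, Finset.sum_eq_single A] at h1
    · simp only [mul_assoc, parityChar_mul_self, mul_one, Finset.sum_const, nsmul_eq_mul,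
        mul_eq_zero, Nat.cast_eq_zero, Finset.card_eq_zero, Finset.filter_eq_empty_iff,
        Finset.mem_univ, true_implies, hA.2, or_false] at h1
      exact h1 (x := 1) (fun _ _ => rfl)
    · intro B _ hBA
      simp only [mul_assoc, ← Finset.mul_sum]
      by_cases hB : a B = 0
      · rw [hB, zero_mul]
      · rw [sum_parityChar_mul_eq_zero, mul_zero]
        intro hsub
        exact hBA (Subtype.ext (Finset.eq_of_subset_of_card_le hsub
          (hmax B (Finset.mem_filter.2 ⟨Finset.mem_univ _, hB⟩))).symm)
    · simp
  have hcard : Fintype.card ({i // i ∉ A.1} → ℤˣ) = 2 ^ (n - A.1.card) := by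
    rw [Fintype.card_fun, Fintype.card_subtype_compl]
    simp
  calc 2 ^ (n - d) ≤ 2 ^ (n - A.1.card) := Nat.pow_le_pow_right two_pos (by have := A.2; omega)
    _ = (Finset.univ : Finset ({i // i ∉ A.1} → ℤˣ)).card := by rw [Finset.card_univ, hcard]
    _ ≤ _ := ?_
  refine Finset.card_le_card_of_surjOn (fun x i => x i.1) ?_
  intro z _
  obtain ⟨y, hy, hfy⟩ := hex fun i => if h : i ∉ A.1 then z ⟨i, h⟩ else 1
  refine ⟨_, by simpa using hfy, ?_⟩
  ext i
  simp [hy i.1 i.2, i.2]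

end PolySpace

/-! ### Counting tuples with independent evaluations -/

section Independent
variable {X : Type*}

/-- Evaluation at `x` as a linear functional on `V`. -/
def evalOn (V : Submodule ℝ (X → ℝ)) (x : X) : V →ₗ[ℝ] ℝ :=
  (LinearMap.proj x).comp V.subtype

@[simp] theorem evalOn_apply (V : Submodule ℝ (X → ℝ)) (x : X) (f : V) :
    evalOn V x f = f.1 x := rfl

/-- If nonzero members of `V` have at least `N` nonzeros, there are at least `N ^ k` sequences
of `k ≤ dim V` points with linearly independent evaluations on `V`. -/
theorem pow_le_card_linearIndependent [Fintype X] [DecidableEq X] (V : Submodule ℝ (X → ℝ)) (N : ℕ)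
    (hN : ∀ f ∈ V, f ≠ 0 → N ≤ (Finset.univ.filter fun x => f x ≠ 0).card) (k : ℕ)
    (hk : k ≤ Module.finrank ℝ V) :
    N ^ k ≤ Nat.card {u : Fin k → X // LinearIndependent ℝ fun i => evalOn V (u i)} := by
  classical
  induction k with
  | zero =>
    have : Nonempty {u : Fin 0 → X // LinearIndependent ℝ fun i => evalOn V (u i)} :=
      ⟨⟨Fin.elim0, linearIndependent_empty_type⟩⟩
    rw [pow_zero]
    exact Nat.card_pos
  | succ k ih =>
    have hext : ∀ u : {u : Fin k → X // LinearIndependent ℝ fun i => evalOn V (u i)},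
        N ≤ Fintype.card {x : X // evalOn V x ∉
          Submodule.span ℝ (Set.range fun i => evalOn V (u.1 i))} := by
      intro u
      let L : V →ₗ[ℝ] (Fin k → ℝ) := LinearMap.pi fun i => evalOn V (u.1 i)
      have hker : LinearMap.ker L ≠ ⊥ :=
        LinearMap.ker_ne_bot_of_finrank_lt (by simpa using hk)
      -- Fewer points than the dimension leave a nonzero `f` vanishing at all of them; every nonzero
      -- of `f` is an admissible next point.
      obtain ⟨f, hf, hf0⟩ := Submodule.exists_mem_ne_zero_of_ne_bot hker
      have hf' : ∀ i, f.1 (u.1 i) = 0 := fun i => congrFun (LinearMap.mem_ker.1 hf) i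
      refine (hN f.1 f.2 (by simpa using hf0)).trans ?_
      rw [Fintype.card_subtype]
      refine Finset.card_le_card fun x hx => ?_
      simp only [Finset.mem_filter, Finset.mem_univ, true_and] at hx ⊢
      intro hmem
      obtain ⟨c, hc⟩ := (Submodule.mem_span_range_iff_exists_fun ℝ).1 hmem
      have := LinearMap.congr_fun hc f
      simp [hf'] at this
      exact hx this.symm
    have hinj : Function.Injective (fun p : (Σ u : {u : Fin k → X //
        LinearIndependent ℝ fun i => evalOn V (u i)}, {x : X // evalOn V x ∉
          Submodule.span ℝ (Set.range fun i => evalOn V (u.1 i))}) =>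
        (⟨Fin.snoc p.1.1 p.2.1, by
          have h := linearIndependent_finSnoc.2 ⟨p.1.2, p.2.2⟩
          have e : (fun i => evalOn V ((Fin.snoc p.1.1 p.2.1 : Fin (k + 1) → X) i)) =
              Fin.snoc (fun i => evalOn V (p.1.1 i)) (evalOn V p.2.1) := by
            funext i
            refine Fin.lastCases ?_ (fun j => ?_) i <;> simp
          rw [e]
          exact h⟩ :
        {u : Fin (k + 1) → X // LinearIndependent ℝ fun i => evalOn V (u i)})) := by
      rintro ⟨⟨u, hu⟩, ⟨x, hx⟩⟩ ⟨⟨u', hu'⟩, ⟨x', hx'⟩⟩ h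
      simp only [Subtype.mk.injEq] at h
      obtain ⟨rfl, rfl⟩ := Fin.snoc_injective2 h
      rfl
    refine le_trans ?_ (Nat.card_le_card_of_injective _ hinj)
    rw [Nat.card_eq_fintype_card, Fintype.card_sigma, pow_succ]
    rw [Nat.card_eq_fintype_card] at ih
    calc _ ≤ _ := Nat.mul_le_mul_right N (ih (by omega))
      _ = ∑ u : {u : Fin k → X // LinearIndependent ℝ fun i => evalOn V (u i)}, N := by simp
      _ ≤ _ := Finset.sum_le_sum fun u _ => hext u

/-- A function vanishing wherever all functions vanishing at the points `P i` vanish is an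
evaluation in the span of the evaluations at the `P i`. -/
theorem exists_evalOn_eq_sum {k : ℕ} (V : Submodule ℝ (X → ℝ)) (P : Fin k → X) (y : X)
    (h : ∀ f ∈ V, (∀ i, f (P i) = 0) → f y = 0) :
    ∃ c : Fin k → ℝ, ∀ f ∈ V, f y = ∑ i, c i * f (P i) := by
  have h1 := mem_span_of_iInf_ker_le_ker (L := fun i => evalOn V (P i)) (K := evalOn V y) (by
    intro f hf
    rw [Submodule.mem_iInf] at hf
    exact h f.1 f.2 fun i => hf i)
  obtain ⟨c, hc⟩ := (Submodule.mem_span_range_iff_exists_fun ℝ).1 h1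
  refine ⟨c, fun f hf => ?_⟩
  have := LinearMap.congr_fun hc ⟨f, hf⟩
  simpa using this.symm

end Independent

/-! ### Littlewood–Offord anticoncentration -/

section LittlewoodOfford

/-- Induction through the recursion for central binomials and (2s+1)(2s+3) ≤ 4(s+1)². -/
theorem centralBinom_sq_mul_le (s : ℕ) : s.centralBinom ^ 2 * (2 * s + 1) ≤ 16 ^ s := by
  induction s with
  | zero => simp
  | succ s ih =>
    have h := Nat.succ_mul_centralBinom_succ s
    have h1 : (s + 1) ^ 2 * ((s + 1).centralBinom ^ 2 * (2 * (s + 1) + 1)) ≤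
        (s + 1) ^ 2 * 16 ^ (s + 1) := by
      calc (s + 1) ^ 2 * ((s + 1).centralBinom ^ 2 * (2 * (s + 1) + 1))
          = ((s + 1) * (s + 1).centralBinom) ^ 2 * (2 * (s + 1) + 1) := by ring
        _ = s.centralBinom ^ 2 * (2 * s + 1) * (4 * ((2 * s + 1) * (2 * s + 3))) := by rw [h]; ring
        _ ≤ 16 ^ s * (4 * (4 * (s + 1) ^ 2)) := by
          refine Nat.mul_le_mul ih (Nat.mul_le_mul_left _ ?_)
          nlinarith
        _ = _ := by ring
    exact Nat.le_of_mul_le_mul_left h1 (by positivity)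

theorem centralBinom_div_le (s : ℕ) :
    (s.centralBinom : ℝ) / 4 ^ s ≤ 1 / √(2 * s + 1) := by
  have h : (s.centralBinom : ℝ) ^ 2 * (2 * s + 1) ≤ 16 ^ s := by
    exact_mod_cast centralBinom_sq_mul_le s
  rw [div_le_div_iff₀ (by positivity) (by positivity), one_mul]
  refine le_of_sq_le_sq ?_ (by positivity)
  rw [mul_pow, Real.sq_sqrt (by positivity), ← pow_mul, mul_comm s 2, pow_mul]
  norm_num
  exact h

/-- The Erdős–Littlewood–Offord bound for signed sums with nonzero coefficients. -/
theorem card_signed_sum_eq_le {ι : Type*} [Fintype ι] [DecidableEq ι] (c : ι → ℝ)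
    (hc : ∀ i, c i ≠ 0) (τ : ℝ) :
    (Finset.univ.filter fun z : ι → ℤˣ => ∑ i, c i * ((z i : ℤ) : ℝ) = τ).card ≤
      (Fintype.card ι).choose (Fintype.card ι / 2) := by
  classical
  let S : (ι → ℤˣ) → Finset ι := fun z => Finset.univ.filter fun i => 0 < c i * ((z i : ℤ) : ℝ)
  have habs : ∀ (z : ι → ℤˣ) i, c i * ((z i : ℤ) : ℝ) = if i ∈ S z then |c i| else -|c i| := by
    intro z i
    simp only [S, Finset.mem_filter, Finset.mem_univ, true_and]
    rcases lt_or_gt_of_ne (hc i) with h | h <;>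
      rcases Int.units_eq_one_or (z i) with hz | hz <;>
      simp [hz, abs_of_pos, abs_of_neg, h, h.le, not_lt.2]
  have hinj : Function.Injective S := by
    intro z z' h
    ext i
    have h1 := habs z i
    rw [h, ← habs z' i] at h1
    exact_mod_cast mul_left_cancel₀ (hc i) h1
  rw [← Finset.card_image_of_injective _ hinj]
  -- Strictly enlarging the set of positive terms strictly increases the sum, so solutions for one
  -- `τ` give an antichain.
  refine IsAntichain.sperner ?_
  intro A hA B hB hne hsub
  simp only [Finset.coe_image, Finset.coe_filter, Finset.mem_univ, true_and, Set.mem_image,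
    Set.mem_ofPred_eq] at hA hB
  obtain ⟨z, hz, rfl⟩ := hA
  obtain ⟨z', hz', rfl⟩ := hB
  obtain ⟨j, hj, hj'⟩ := Finset.exists_of_ssubset (Finset.ssubset_iff_subset_ne.2 ⟨hsub, hne⟩)
  have : ∑ i, c i * ((z i : ℤ) : ℝ) < ∑ i, c i * ((z' i : ℤ) : ℝ) := by
    refine Finset.sum_lt_sum (fun i _ => ?_) ⟨j, Finset.mem_univ _, ?_⟩
    · rw [habs z, habs z']
      have := @hsub i
      have := abs_nonneg (c i)
      split_ifs <;> first | linarith | tauto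
    · rw [habs z, habs z', if_pos hj, if_neg hj']
      have := abs_pos.2 (hc j)
      linarith
  linarith

/-- Fix the signs outside a set `J` of `2 * s` nonzero coefficients and apply the previous bound on
`J`. -/
theorem card_signed_sum_eq_le_of_support {k s : ℕ} (c : Fin k → ℝ)
    (hc : 2 * s ≤ (Finset.univ.filter fun i => c i ≠ 0).card) (τ : ℝ) :
    (Finset.univ.filter fun z : Fin k → ℤˣ => ∑ i, c i * ((z i : ℤ) : ℝ) = τ).card * 4 ^ s ≤
      2 ^ k * s.centralBinom := by
  classical
  obtain ⟨J, hJ, hJc⟩ := Finset.exists_subset_card_eq hc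
  have hJk : 2 * s ≤ k := by simpa [hJc] using Finset.card_le_univ J
  have hcardJ : Fintype.card {i // i ∈ J} = 2 * s := by simp [hJc]
  have hle : (Finset.univ.filter fun z : Fin k → ℤˣ => ∑ i, c i * ((z i : ℤ) : ℝ) = τ).card ≤
      s.centralBinom * Fintype.card ({i // i ∉ J} → ℤˣ) := by
    refine Finset.card_le_mul_card_image_of_maps_to
      (f := fun z (i : {i // i ∉ J}) => z i.1) (t := Finset.univ) (by simp) _ ?_
    intro b _
    have h1 := card_signed_sum_eq_le (fun i : {i // i ∈ J} => c i.1)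
      (fun i => (Finset.mem_filter.1 (hJ i.2)).2) (τ - ∑ i : {i // i ∉ J}, c i * ((b i : ℤ) : ℝ))
    rw [hcardJ, Nat.mul_div_cancel_left _ two_pos, ← Nat.centralBinom_eq_two_mul_choose] at h1
    refine le_trans (Finset.card_le_card_of_injOn (fun z i => z i.1) ?_ ?_) h1
    · intro z hz
      simp only [Finset.coe_filter, Finset.mem_filter, Finset.mem_univ, true_and,
        Set.mem_ofPred_eq] at hz ⊢
      obtain ⟨hz, rfl⟩ := hz
      rw [← hz, ← Fintype.sum_subtype_add_sum_subtype (fun i => i ∈ J),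
        add_sub_cancel_right]
      exact Finset.sum_congr (by ext; simp) fun _ _ => rfl
    · intro z hz z' hz' h
      simp only [Finset.coe_filter, Finset.mem_filter, Finset.mem_univ, true_and,
        Set.mem_ofPred_eq] at hz hz'
      funext i
      by_cases hi : i ∈ J
      · exact congrFun h ⟨i, hi⟩
      · exact congrFun (hz.2.trans hz'.2.symm) ⟨i, hi⟩
  have hcompl : Fintype.card ({i // i ∉ J} → ℤˣ) = 2 ^ (k - 2 * s) := by
    rw [Fintype.card_fun, Fintype.card_subtype_compl]
    simp [hJc]
  rw [hcompl] at hle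
  calc _ ≤ s.centralBinom * 2 ^ (k - 2 * s) * 4 ^ s := Nat.mul_le_mul_right _ hle
    _ = s.centralBinom * (2 ^ (k - 2 * s) * 2 ^ (2 * s)) := by
      rw [pow_mul 2 2 s]; norm_num; ring
    _ = _ := by rw [← pow_add, Nat.sub_add_cancel hJk, mul_comm]

/-- A signed sum with at least `2 s` nonzero coefficients is rarely `±1`. -/
theorem card_signed_sum_unit_le {k s : ℕ} (c : Fin k → ℝ)
    (hc : 2 * s ≤ (Finset.univ.filter fun i => c i ≠ 0).card) :
    (Nat.card {z : Fin k → ℤˣ // ∃ e : ℤˣ, ((e : ℤ) : ℝ) = ∑ i, c i * ((z i : ℤ) : ℝ)} : ℝ) ≤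
      2 ^ k * (2 / √(2 * s + 1)) := by
  classical
  have hone : ∀ τ : ℝ,
      ((Finset.univ.filter fun z : Fin k → ℤˣ => ∑ i, c i * ((z i : ℤ) : ℝ) = τ).card : ℝ) ≤
        2 ^ k * (1 / √(2 * s + 1)) := by
    intro τ
    have h1 : (((Finset.univ.filter fun z : Fin k → ℤˣ =>
        ∑ i, c i * ((z i : ℤ) : ℝ) = τ).card : ℝ)) * 4 ^ s ≤ 2 ^ k * s.centralBinom := by
      exact_mod_cast card_signed_sum_eq_le_of_support c hc τ
    rw [← le_div_iff₀ (by positivity), mul_div_assoc] at h1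
    exact h1.trans (mul_le_mul_of_nonneg_left (centralBinom_div_le s) (by positivity))
  have hsub : (Finset.univ.filter fun z : Fin k → ℤˣ =>
      ∃ e : ℤˣ, ((e : ℤ) : ℝ) = ∑ i, c i * ((z i : ℤ) : ℝ)) ⊆
      (Finset.univ.filter fun z : Fin k → ℤˣ => ∑ i, c i * ((z i : ℤ) : ℝ) = 1) ∪
      (Finset.univ.filter fun z : Fin k → ℤˣ => ∑ i, c i * ((z i : ℤ) : ℝ) = -1) := by
    intro z hz
    obtain ⟨e, he⟩ := (Finset.mem_filter.1 hz).2
    rw [Finset.mem_union, Finset.mem_filter, Finset.mem_filter, ← he]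
    rcases Int.units_eq_one_or e with rfl | rfl <;> simp
  rw [Nat.card_eq_fintype_card, Fintype.card_subtype]
  calc _ ≤ _ := Nat.cast_le.2 ((Finset.card_le_card hsub).trans (Finset.card_union_le _ _))
    _ ≤ 2 ^ k * (1 / √(2 * s + 1)) + 2 ^ k * (1 / √(2 * s + 1)) := by
      rw [Nat.cast_add]
      exact add_le_add (hone _) (hone _)
    _ = _ := by ring

end LittlewoodOfford

/-! ### From zero closures to threshold functions -/

section Flats

/-- As constants lie in the space, a generic function has no zero on the cube. -/
theorem card_signPats_polySpace_le (n d : ℕ) :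
    (signPats (polySpace n d) Finset.univ).card ≤ numPolyThreshold n d := by
  classical
  rw [numPolyThreshold, Nat.card_eq_fintype_card, Fintype.card_subtype]
  refine Finset.card_le_card_of_injOn (fun P x => if x ∈ P then 1 else -1) ?_ ?_
  · intro P hP
    obtain ⟨-, f, ⟨p, hp, hfp⟩, hgen, hfP⟩ := mem_signPats.1 hP
    rw [Finset.mem_coe, Finset.mem_filter]
    refine ⟨Finset.mem_univ _, p, hp, fun x => ?_⟩
    have hne : f x ≠ 0 := fun h => by
      simpa using hgen x (Finset.mem_univ _) h 1 (one_mem_polySpace n d)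
    rw [← hfp]
    refine ⟨hne, ?_⟩
    rcases lt_or_gt_of_ne hne with h | h
    · simp [hfP x (Finset.mem_univ _), Real.sign_of_neg h, h.not_gt]
    · simp [hfP x (Finset.mem_univ _), Real.sign_of_pos h, h]
  · intro P _ Q _ h
    ext x
    have := congrFun h x
    by_cases hP : x ∈ P <;> by_cases hQ : x ∈ Q <;> simp [hP, hQ] at this ⊢

theorem numPolyThreshold_le {n d : ℕ} (hd : 1 ≤ d) (hdn : d ≤ n) :
    numPolyThreshold n d ≤ (2 ^ n) ^ binomSum n d := by
  classical
  rw [numPolyThreshold, Nat.card_eq_fintype_card, Fintype.card_subtype]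
  let S : ((Fin n → ℤˣ) → ℤˣ) → Finset (Fin n → ℤˣ) := fun f => Finset.univ.filter fun x => f x = 1
  have hinj : Function.Injective S := by
    intro v w h
    funext i
    have := Finset.ext_iff.1 h i
    simp only [S, Finset.mem_filter, Finset.mem_univ, true_and] at this
    rcases Int.units_eq_one_or (v i) with hv | hv <;>
      rcases Int.units_eq_one_or (w i) with hw | hw <;> simp [hv, hw] at this ⊢
  rw [← Finset.card_image_of_injective _ hinj]
  have h := card_posSets_le (polySpace n d) _ (finrank_polySpace n d).le
    ((Finset.univ.filter (IsPolyThreshold n d)).image S) (by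
      intro P hP
      obtain ⟨f, hf, rfl⟩ := Finset.mem_image.1 hP
      obtain ⟨p, hp, h⟩ := (Finset.mem_filter.1 hf).2
      refine ⟨_, ⟨p, hp, fun _ => rfl⟩, fun x => ?_⟩
      obtain ⟨hne, hfx⟩ := h x
      simp only [S, Finset.mem_filter, Finset.mem_univ, true_and]
      rcases lt_or_gt_of_ne hne with h | h
      · rw [Real.sign_of_neg h] at hfx
        have hfx' : f x = -1 := (Int.units_eq_one_or (f x)).resolve_left fun h1 => by
          norm_num [h1] at hfx
        simp [hfx', h.not_gt]
      · rw [Real.sign_of_pos h] at hfx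
        have hfx' : f x = 1 := (Int.units_eq_one_or (f x)).resolve_right fun h1 => by
          norm_num [h1] at hfx
        simp [hfx', h])
  rw [Fintype.card_fun, Fintype.card_units_int, Fintype.card_fin] at h
  refine h.trans (sum_range_choose_le_pow_of_two_le _ _ ?_ ?_)
  · exact Nat.le_self_pow (by omega) 2
  · rw [binomSum]
    calc 2 ≤ n.choose 0 + n.choose 1 := by simp; omega
      _ = ∑ k ∈ Finset.range 2, n.choose k := by simp [Finset.sum_range_succ]
      _ ≤ _ := Finset.sum_le_sum_of_subset (Finset.range_mono (by omega))

theorem comp_castAdd_mem_polySpace {m d : ℕ} (r : ℕ) {f : (Fin m → ℤˣ) → ℝ}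
    (hf : f ∈ polySpace m d) :
    (fun x : Fin (m + r) → ℤˣ => f fun i => x (Fin.castAdd r i)) ∈ polySpace (m + r) d := by
  obtain ⟨p, hp, h⟩ := hf
  refine ⟨MvPolynomial.rename (Fin.castAdd r) p,
    (MvPolynomial.totalDegree_rename_le _ p).trans hp, fun x => ?_⟩
  rw [MvPolynomial.eval_rename]
  exact h _

theorem coord_mem_polySpace {n d : ℕ} (hd : 1 ≤ d) (j : Fin n) :
    (fun x : Fin n → ℤˣ => ((x j : ℤ) : ℝ)) ∈ polySpace n d :=
  ⟨MvPolynomial.X j, by simpa [MvPolynomial.totalDegree_X] using hd, fun x => by simp⟩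

open Classical in
/-- The points at which every member of `V` vanishing at all `P i` vanishes. -/
noncomputable def zeroClosure {X : Type*} [Fintype X] {k : ℕ} (V : Submodule ℝ (X → ℝ))
    (P : Fin k → X) : Finset X :=
  Finset.univ.filter fun y => ∀ f ∈ V, (∀ i, f (P i) = 0) → f y = 0

theorem mem_zeroClosure {X : Type*} [Fintype X] {k : ℕ} {V : Submodule ℝ (X → ℝ)}
    {P : Fin k → X} {y : X} :
    y ∈ zeroClosure V P ↔ ∀ f ∈ V, (∀ i, f (P i) = 0) → f y = 0 := by
  simp [zeroClosure]

/-- A generic element of the subspace vanishing at the `P i` vanishes only at its common zeros. -/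
theorem zeroClosure_mem_zeroPats {X : Type*} [Fintype X] [DecidableEq X] {k : ℕ}
    (V : Submodule ℝ (X → ℝ)) (P : Fin k → X) :
    zeroClosure V P ∈ zeroPats V Finset.univ := by
  let U : Submodule ℝ (X → ℝ) :=
    V ⊓ ⨅ i, LinearMap.ker (LinearMap.proj (P i) : (X → ℝ) →ₗ[ℝ] ℝ)
  have hU : ∀ f, f ∈ U ↔ f ∈ V ∧ ∀ i, f (P i) = 0 := fun f => by simp [U]
  obtain ⟨f, hf, hgen⟩ := exists_isGenericOn U Finset.univ
  refine mem_zeroPats.2 ⟨Finset.subset_univ _, f, ((hU f).1 hf).1, fun y _ => ?_⟩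
  rw [mem_zeroClosure]
  exact ⟨fun h => h f ((hU f).1 hf).1 ((hU f).1 hf).2,
    fun h g hg hgP => hgen y (Finset.mem_univ _) h g ((hU g).2 ⟨hg, hgP⟩)⟩

/-- A linear span of `t` vectors contains at most `(m + 1) ^ t` points of the cube. -/
theorem card_cube_inter_span_le {m t : ℕ} {ι : Type*} [Fintype ι] (hι : Fintype.card ι ≤ t)
    (a : ι → Fin m → ℝ) (𝒱 : Finset (Fin m → ℤˣ))
    (h𝒱 : ∀ v ∈ 𝒱, (fun i => ((v i : ℤ) : ℝ)) ∈ Submodule.span ℝ (Set.range a)) :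
    𝒱.card ≤ (m + 1) ^ t := by
  classical
  -- Cube points are read as functions on the `m` coordinates, and each is determined by its
  -- positivity set.
  let S : (Fin m → ℤˣ) → Finset (Fin m) := fun v => Finset.univ.filter fun i => v i = 1
  have hinj : Function.Injective S := by
    intro v w h
    funext i
    have := Finset.ext_iff.1 h i
    simp only [S, Finset.mem_filter, Finset.mem_univ, true_and] at this
    rcases Int.units_eq_one_or (v i) with hv | hv <;>
      rcases Int.units_eq_one_or (w i) with hw | hw <;> simp [hv, hw] at this ⊢
  rw [← Finset.card_image_of_injective _ hinj]
  have h := card_posSets_le (Submodule.span ℝ (Set.range a)) t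
    ((finrank_range_le_card a).trans hι) (𝒱.image S) (by
      intro P hP
      obtain ⟨v, hv, rfl⟩ := Finset.mem_image.1 hP
      refine ⟨_, h𝒱 v hv, fun i => ?_⟩
      rcases Int.units_eq_one_or (v i) with h | h <;> simp [S, h])
  rw [Fintype.card_fin] at h
  exact h.trans (sum_range_choose_le_pow m t)

/-- Few cube points have an evaluation that is a sparse combination of given evaluations. -/
theorem card_sparse_le {m d k t : ℕ} (hd : 1 ≤ d) (u : Fin k → Fin m → ℤˣ)
    (𝒱 : Finset (Fin m → ℤˣ))
    (h𝒱 : ∀ v ∈ 𝒱, ∃ c : Fin k → ℝ, (Finset.univ.filter fun i => c i ≠ 0).card ≤ t ∧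
      ∀ f ∈ polySpace m d, f v = ∑ i, c i * f (u i)) :
    𝒱.card ≤ ((k + 1) * (m + 1)) ^ t := by
  classical
  -- Testing a sparse relation on the coordinate functions, of degree 1 ≤ `d`, puts `v` in the span
  -- of at most `t` of the points `u i`.
  let 𝒱' : {I : Finset (Fin k) // I.card ≤ t} → Finset (Fin m → ℤˣ) := fun I =>
    𝒱.filter fun v => (fun i => ((v i : ℤ) : ℝ)) ∈
      Submodule.span ℝ (Set.range fun (j : I.1) i => ((u j i : ℤ) : ℝ))
  have hcover : 𝒱 ⊆ Finset.univ.biUnion 𝒱' := by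
    intro v hv
    obtain ⟨c, hc, hrep⟩ := h𝒱 v hv
    refine Finset.mem_biUnion.2 ⟨⟨_, hc⟩, Finset.mem_univ _, Finset.mem_filter.2 ⟨hv, ?_⟩⟩
    refine (Submodule.mem_span_range_iff_exists_fun ℝ).2 ⟨fun j => c j, ?_⟩
    funext i
    rw [hrep _ (coord_mem_polySpace hd i), Finset.sum_apply]
    simp only [Pi.smul_apply, smul_eq_mul]
    rw [Finset.sum_coe_sort (Finset.univ.filter fun i => c i ≠ 0)
      (fun j => c j * ((u j i : ℤ) : ℝ))]
    refine Finset.sum_subset (Finset.subset_univ _) fun j _ hj => ?_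
    simp only [Finset.mem_filter, Finset.mem_univ, true_and, not_not] at hj
    rw [hj, zero_mul]
  calc 𝒱.card ≤ ∑ I, (𝒱' I).card := (Finset.card_le_card hcover).trans Finset.card_biUnion_le
    _ ≤ ∑ _I : {I : Finset (Fin k) // I.card ≤ t}, (m + 1) ^ t := Finset.sum_le_sum fun I _ =>
        card_cube_inter_span_le (by simpa using I.2) _ _ fun v hv => (Finset.mem_filter.1 hv).2
    _ = binomSum k t * (m + 1) ^ t := by
        rw [Finset.sum_const, Finset.card_univ, card_subtype_card_le, smul_eq_mul]
    _ ≤ (k + 1) ^ t * (m + 1) ^ t := Nat.mul_le_mul_right _ (sum_range_choose_le_pow k t)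
    _ = _ := (mul_pow _ _ _).symm

/-- Append to each of the `k` points `u i` the `i`-th entries of the `r` sign vectors `z`. -/
def extendPoints {m r k : ℕ} (u : Fin k → Fin m → ℤˣ) (z : Fin r → Fin k → ℤˣ) :
    Fin k → Fin (m + r) → ℤˣ :=
  fun i => Fin.append (u i) fun j => z j i

theorem representation_unique {X : Type*} {k : ℕ} {V : Submodule ℝ (X → ℝ)} {u : Fin k → X}
    (hu : LinearIndependent ℝ fun i => evalOn V (u i)) {v : X} {c c' : Fin k → ℝ}
    (hc : ∀ f ∈ V, f v = ∑ i, c i * f (u i)) (hc' : ∀ f ∈ V, f v = ∑ i, c' i * f (u i)) :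
    c = c' := by
  have := Fintype.linearIndependent_iff.1 hu (c - c') (by
    ext f
    simp [sub_mul, ← hc f.1 f.2, ← hc' f.1 f.2])
  exact funext fun i => sub_eq_zero.1 (this i)

/-- The relation for `y` is tested on functions of the old coordinates and on each new coordinate.
-/
theorem representation_of_mem_zeroClosure {m r d k : ℕ} (hd : 1 ≤ d) {u : Fin k → Fin m → ℤˣ}
    {z : Fin r → Fin k → ℤˣ} {y : Fin (m + r) → ℤˣ}
    (hy : y ∈ zeroClosure (polySpace (m + r) d) (extendPoints u z)) :
    ∃ c : Fin k → ℝ, (∀ f ∈ polySpace m d, f (fun i => y (Fin.castAdd r i)) = ∑ i, c i * f (u i)) ∧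
      ∀ j, ((y (Fin.natAdd m j) : ℤ) : ℝ) = ∑ i, c i * ((z j i : ℤ) : ℝ) := by
  obtain ⟨c, hc⟩ := exists_evalOn_eq_sum _ _ y (mem_zeroClosure.1 hy)
  refine ⟨c, fun f hf => ?_, fun j => ?_⟩
  · simpa [extendPoints] using hc _ (comp_castAdd_mem_polySpace r hf)
  · simpa [extendPoints] using hc _ (coord_mem_polySpace hd (Fin.natAdd m j))

/-- Points with independent evaluations can be extended by `r` coordinates so that the zero
closure of the extended points is small. -/
theorem exists_card_zeroClosure_le {m r d k s : ℕ} (hd : 1 ≤ d) (u : Fin k → Fin m → ℤˣ)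
    (hu : LinearIndependent ℝ fun i => evalOn (polySpace m d) (u i))
    (hs : 2 ^ m * (2 / √(2 * s + 1)) ^ r < 1) :
    ∃ z : Fin r → Fin k → ℤˣ,
      (zeroClosure (polySpace (m + r) d) (extendPoints u z)).card ≤
        ((k + 1) * (m + 1)) ^ (2 * s) := by
  classical
  let Rep : (Fin m → ℤˣ) → (Fin k → ℝ) → Prop := fun v c =>
    ∀ f ∈ polySpace m d, f v = ∑ i, c i * f (u i)
  let Bad : (Fin m → ℤˣ) → (Fin r → Fin k → ℤˣ) → Prop := fun v z => ∃ c, Rep v c ∧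
    2 * s ≤ (Finset.univ.filter fun i => c i ≠ 0).card ∧
    ∀ j, ∃ e : ℤˣ, ((e : ℤ) : ℝ) = ∑ i, c i * ((z j i : ℤ) : ℝ)
  have hbad : ∀ v, ((Finset.univ.filter (Bad v)).card : ℝ) ≤
      (2 ^ k * (2 / √(2 * s + 1))) ^ r := by
    intro v
    by_cases hv : ∃ c, Rep v c ∧ 2 * s ≤ (Finset.univ.filter fun i => c i ≠ 0).card
    · obtain ⟨c, hc, hcs⟩ := hv
      have hsub : Finset.univ.filter (Bad v) ⊆ Fintype.piFinset fun _ : Fin r =>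
          Finset.univ.filter fun z : Fin k → ℤˣ =>
            ∃ e : ℤˣ, ((e : ℤ) : ℝ) = ∑ i, c i * ((z i : ℤ) : ℝ) := by
        intro z hz
        obtain ⟨c', hc', -, h⟩ := (Finset.mem_filter.1 hz).2
        -- The coefficients depend on `v` alone, not on `z`, so the `r` sign vectors impose
        -- independent conditions.
        obtain rfl := representation_unique hu hc hc'
        rw [Fintype.mem_piFinset]
        exact fun j => Finset.mem_filter.2 ⟨Finset.mem_univ _, h j⟩
      have hcard := Finset.card_le_card hsub
      rw [Fintype.card_piFinset_const] at hcard
      have hunit := card_signed_sum_unit_le c hcs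
      rw [Nat.card_eq_fintype_card, Fintype.card_subtype] at hunit
      refine (Nat.cast_le (α := ℝ).2 hcard).trans ?_
      rw [Nat.cast_pow]
      exact pow_le_pow_left₀ (by positivity) hunit r
    · rw [Finset.filter_false_of_mem, Finset.card_empty, Nat.cast_zero]
      · positivity
      · rintro z - ⟨c, hc, hcs, -⟩
        exact hv ⟨c, hc, hcs⟩
  obtain ⟨z, hz⟩ : ∃ z, ∀ v, ¬ Bad v z := by
    by_contra! hcon
    have hcover : (Finset.univ : Finset (Fin r → Fin k → ℤˣ)) ⊆
        Finset.univ.biUnion fun v => Finset.univ.filter (Bad v) := by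
      intro z _
      obtain ⟨v, hv⟩ := hcon z
      exact Finset.mem_biUnion.2
        ⟨v, Finset.mem_univ _, Finset.mem_filter.2 ⟨Finset.mem_univ _, hv⟩⟩
    have h1 := (Finset.card_le_card hcover).trans Finset.card_biUnion_le
    have h2 : ((2 : ℝ) ^ k) ^ r ≤ 2 ^ m * (2 ^ k * (2 / √(2 * s + 1))) ^ r := by
      calc ((2 : ℝ) ^ k) ^ r = ((Finset.univ : Finset (Fin r → Fin k → ℤˣ)).card : ℝ) := by
            simp [Finset.card_univ]
        _ ≤ ∑ v : Fin m → ℤˣ, ((Finset.univ.filter (Bad v)).card : ℝ) := by exact_mod_cast h1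
        _ ≤ ∑ v : Fin m → ℤˣ, (2 ^ k * (2 / √(2 * s + 1))) ^ r :=
            Finset.sum_le_sum fun v _ => hbad v
        _ = _ := by simp
    rw [mul_pow] at h2
    have h3 : (0 : ℝ) < (2 ^ k) ^ r := by positivity
    nlinarith
  refine ⟨z, ?_⟩
  -- The old coordinates determine `c`, which determines the new ones; it is enough to count
  -- truncations.
  have hinj : Set.InjOn (fun (y : Fin (m + r) → ℤˣ) i => y (Fin.castAdd r i))
      (zeroClosure (polySpace (m + r) d) (extendPoints u z)) := by
    intro y hy y' hy' h
    obtain ⟨c, hc, hcz⟩ := representation_of_mem_zeroClosure hd hy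
    obtain ⟨c', hc', hcz'⟩ := representation_of_mem_zeroClosure hd hy'
    simp only at h
    rw [← h] at hc'
    obtain rfl := representation_unique hu hc hc'
    funext i
    refine Fin.addCases (fun i => congrFun h i) (fun j => ?_) i
    have := (hcz j).trans (hcz' j).symm
    exact_mod_cast this
  rw [← Finset.card_image_of_injOn hinj]
  refine card_sparse_le hd u _ fun v hv => ?_
  obtain ⟨y, hy, rfl⟩ := Finset.mem_image.1 hv
  obtain ⟨c, hc, hcz⟩ := representation_of_mem_zeroClosure hd hy
  refine ⟨c, ?_, hc⟩
  by_contra! hlt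
  exact hz _ ⟨c, hc, hlt.le, fun j => ⟨_, hcz j⟩⟩

/-- The number of threshold functions is bounded below by counting zero closures. -/
theorem two_pow_le_mul_numPolyThreshold {m r d s : ℕ} (hd : 1 ≤ d)
    (hs : (2 : ℝ) ^ m * (2 / √(2 * s + 1)) ^ r < 1) :
    (2 ^ (m - d)) ^ binomSum m d ≤
      (((binomSum m d + 1) * (m + 1)) ^ (2 * s)) ^ binomSum m d * numPolyThreshold (m + r) d := by
  classical
  set k := binomSum m d
  set M := ((k + 1) * (m + 1)) ^ (2 * s)
  have h1 := pow_le_card_linearIndependent (polySpace m d) (2 ^ (m - d))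
    (fun f hf h0 => card_nonzeros_ge hf h0) k (finrank_polySpace m d).ge
  choose! z hz using fun (u : Fin k → Fin m → ℤˣ)
    (hu : LinearIndependent ℝ fun i => evalOn (polySpace m d) (u i)) =>
    exists_card_zeroClosure_le (r := r) hd u hu hs
  rw [Nat.card_eq_fintype_card, Fintype.card_subtype] at h1
  refine h1.trans (le_trans ?_ (Nat.mul_le_mul_left _ ((card_zeroPats_le_card_signPats
    (polySpace (m + r) d) Finset.univ).trans (card_signPats_polySpace_le _ _))))
  refine Finset.card_le_mul_card_image_of_maps_to
    (f := fun u => zeroClosure (polySpace (m + r) d) (extendPoints u (z u)))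
    (fun u _ => zeroClosure_mem_zeroPats _ _) _ fun F _ => ?_
  -- Every `u i` is the truncation of a point of its closure `F`, so `F` arises from at most `M ^ k`
  -- tuples. A larger `F` never arises.
  by_cases hF : F.card ≤ M
  · have hsub : (Finset.univ.filter fun u : Fin k → Fin m → ℤˣ =>
        LinearIndependent ℝ fun i => evalOn (polySpace m d) (u i)).filter (fun u =>
        zeroClosure (polySpace (m + r) d) (extendPoints u (z u)) = F) ⊆
        Fintype.piFinset fun _ : Fin k => F.image fun y i => y (Fin.castAdd r i) := by
      intro u hu
      obtain ⟨-, rfl⟩ := Finset.mem_filter.1 hu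
      rw [Fintype.mem_piFinset]
      exact fun i => Finset.mem_image.2 ⟨extendPoints u (z u) i,
        mem_zeroClosure.2 fun f _ h => h i, by simp [extendPoints]⟩
    refine (Finset.card_le_card hsub).trans ?_
    rw [Fintype.card_piFinset_const]
    exact Nat.pow_le_pow_left (Finset.card_image_le.trans hF) k
  · rw [Finset.filter_false_of_mem]
    · simp
    · rintro u hu rfl
      exact hF (hz u (Finset.mem_filter.1 hu).2)

end Flats

/-! ### Choice of parameters and asymptotics -/

section Estimates

/-- The quotient C(m,j)/C(n,j) is a product of factors (m-i)/(n-i) with i < j ≤ d, each at least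
(m-d)/(n-d). -/
theorem pow_mul_choose_le_choose {m n d j : ℕ} (hmn : m ≤ n) (hdm : d < m) (hj : j ≤ d) :
    (((m : ℝ) - d) / (n - d)) ^ j * n.choose j ≤ m.choose j := by
  have hdm' : (d : ℝ) < m := by exact_mod_cast hdm
  have hmn' : (m : ℝ) ≤ n := by exact_mod_cast hmn
  induction j with
  | zero => simp
  | succ j ih =>
    have hjd : (j : ℝ) + 1 ≤ d := by exact_mod_cast hj
    have h1 : (n.choose (j + 1) : ℝ) * (j + 1) = n.choose j * (n - j) := by
      rw [← Nat.cast_sub (by omega)]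
      exact_mod_cast Nat.choose_succ_right_eq n j
    have h2 : (m.choose (j + 1) : ℝ) * (j + 1) = m.choose j * (m - j) := by
      rw [← Nat.cast_sub (by omega)]
      exact_mod_cast Nat.choose_succ_right_eq m j
    have h3 : ((m : ℝ) - d) / (n - d) * (n - j) ≤ m - j := by
      rw [div_mul_eq_mul_div, div_le_iff₀ (by linarith)]
      nlinarith
    have hj0 : (0 : ℝ) < j + 1 := by positivity
    refine le_of_mul_le_mul_right ?_ hj0
    rw [mul_assoc, h1, h2, pow_succ]
    calc _ = ((((m : ℝ) - d) / (n - d)) ^ j * n.choose j) *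
          (((m : ℝ) - d) / (n - d) * (n - j)) := by ring
      _ ≤ m.choose j * (m - j) := by
        refine mul_le_mul (ih (by omega)) h3 (mul_nonneg (div_nonneg ?_ ?_) ?_) (by positivity) <;>
          linarith

theorem pow_mul_binomSum_le_binomSum {m n d : ℕ} (hmn : m ≤ n) (hdm : d < m) :
    (((m : ℝ) - d) / (n - d)) ^ d * binomSum n d ≤ binomSum m d := by
  have hdm' : (d : ℝ) < m := by exact_mod_cast hdm
  have hmn' : (m : ℝ) ≤ n := by exact_mod_cast hmn
  rw [binomSum, binomSum, Nat.cast_sum, Nat.cast_sum, Finset.mul_sum]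
  refine Finset.sum_le_sum fun j hj => ?_
  rw [Finset.mem_range, Nat.lt_succ_iff] at hj
  refine le_trans ?_ (pow_mul_choose_le_choose hmn hdm hj)
  have h0 : 0 ≤ ((m : ℝ) - d) / (n - d) := div_nonneg (by linarith) (by linarith)
  have h1 : ((m : ℝ) - d) / (n - d) ≤ 1 := div_le_one_of_le₀ (by linarith) (by linarith)
  exact mul_le_mul_of_nonneg_right (pow_le_pow_of_le_one h0 h1 hj) (Nat.cast_nonneg _)

/-- The logarithmic form of `two_pow_le_mul_numPolyThreshold`. -/
theorem binomSum_mul_le_logb {m r d s : ℕ} (hd : 1 ≤ d) (hdm : d ≤ m)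
    (hs : (2 : ℝ) ^ m * (2 / √(2 * s + 1)) ^ r < 1) :
    (binomSum m d : ℝ) * ((m : ℝ) - d - 6 * s * d * Real.logb 2 (m + 1)) ≤
      Real.logb 2 (numPolyThreshold (m + r) d) := by
  have h := two_pow_le_mul_numPolyThreshold hd hs
  set k := binomSum m d
  set T := numPolyThreshold (m + r) d
  have hT : T ≠ 0 := by
    intro h0
    rw [h0, mul_zero] at h
    exact absurd h (not_le.2 (by positivity))
  have hk : k + 1 ≤ (m + 1) ^ (d + 1) := by
    have h1 : k ≤ (m + 1) ^ d := sum_range_choose_le_pow m d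
    have h2 : 1 ≤ (m + 1) ^ d := Nat.one_le_pow _ _ (by omega)
    rw [pow_succ]
    nlinarith
  have hM : (((k + 1) * (m + 1)) ^ (2 * s)) ≤ (m + 1) ^ (6 * s * d) := by
    calc _ ≤ ((m + 1) ^ (d + 1) * (m + 1)) ^ (2 * s) := by gcongr
      _ = (m + 1) ^ ((d + 2) * (2 * s)) := by rw [← pow_succ, ← pow_mul]
      -- Since `d ≥ 1`, 2(d + 2) ≤ 6d.
      _ ≤ _ := Nat.pow_le_pow_right (by omega) (by nlinarith)
  have h' : (2 ^ (m - d)) ^ k ≤ ((m + 1) ^ (6 * s * d)) ^ k * T :=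
    h.trans (by gcongr)
  have h'' : (((2 : ℝ) ^ (m - d)) ^ k) ≤ (((m : ℝ) + 1) ^ (6 * s * d)) ^ k * T := by
    exact_mod_cast h'
  have h3 := Real.logb_le_logb_of_le (b := 2) (by norm_num) (by positivity) h''
  have hT' : (T : ℝ) ≠ 0 := by exact_mod_cast hT
  rw [Real.logb_mul (by positivity) hT', Real.logb_pow, Real.logb_pow, Real.logb_pow, Real.logb_pow,
    Real.logb_self_eq_one (by norm_num), Nat.cast_sub hdm] at h3
  push_cast at h3
  linarith

theorem rpow_nine_tenths_le {n : ℕ} (hL : 0 < Real.log n) :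
    (n : ℝ) ^ (0.9 : ℝ) ≤ 10 * (n / Real.log n) := by
  have h := Real.log_le_rpow_div (Nat.cast_nonneg n) (show (0 : ℝ) < 0.1 by norm_num)
  have hn : (0 : ℝ) < n := lt_of_le_of_ne (Nat.cast_nonneg n) fun h0 => by simp [← h0] at hL
  rw [← mul_div_assoc, le_div_iff₀ hL]
  calc _ ≤ (n : ℝ) ^ (0.9 : ℝ) * ((n : ℝ) ^ (0.1 : ℝ) / 0.1) := by gcongr
    _ = 10 * ((n : ℝ) ^ (0.9 : ℝ) * (n : ℝ) ^ (0.1 : ℝ)) := by ring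
    _ = _ := by rw [← Real.rpow_add hn]; norm_num

theorem rpow_mul_rpow_mul_log_le {n : ℕ} (hL : 0 < Real.log n) :
    (n : ℝ) ^ (0.05 : ℝ) * (n : ℝ) ^ (0.9 : ℝ) * Real.log n ≤ 1600 * (n / Real.log n) := by
  have h := Real.log_le_rpow_div (Nat.cast_nonneg n) (show (0 : ℝ) < 0.025 by norm_num)
  have hn : (0 : ℝ) < n := lt_of_le_of_ne (Nat.cast_nonneg n) fun h0 => by simp [← h0] at hL
  rw [← mul_div_assoc, le_div_iff₀ hL]
  calc _ = (n : ℝ) ^ (0.05 : ℝ) * (n : ℝ) ^ (0.9 : ℝ) * (Real.log n * Real.log n) := by ring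
    _ ≤ (n : ℝ) ^ (0.05 : ℝ) * (n : ℝ) ^ (0.9 : ℝ) *
        ((n : ℝ) ^ (0.025 : ℝ) / 0.025 * ((n : ℝ) ^ (0.025 : ℝ) / 0.025)) := by gcongr
    _ = 1600 * ((n : ℝ) ^ (0.05 : ℝ) * (n : ℝ) ^ (0.9 : ℝ) * (n : ℝ) ^ (0.025 : ℝ) *
        (n : ℝ) ^ (0.025 : ℝ)) := by ring
    _ = _ := by rw [← Real.rpow_add hn, ← Real.rpow_add hn, ← Real.rpow_add hn]; norm_num

/-- With E = n^(1/80), the root is at least E², and E ≥ 2 gives 2/E² ≤ 1/E. -/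
theorem two_div_sqrt_le_exp {n : ℕ} (hL : 80 ≤ Real.log n) :
    2 / √(2 * (⌊(n : ℝ) ^ (0.05 : ℝ)⌋₊ : ℝ) + 1) ≤ Real.exp (-(Real.log n / 80)) := by
  have hn : (0 : ℝ) < n := lt_of_le_of_ne (Nat.cast_nonneg n) fun h0 => by
    norm_num [← h0] at hL
  set E := Real.exp (Real.log n / 80)
  have hE : 2 ≤ E := by
    have := Real.add_one_le_exp (Real.log n / 80)
    linarith
  have hpow : (n : ℝ) ^ (0.05 : ℝ) = (E ^ 2) ^ 2 := by
    rw [Real.rpow_def_of_pos hn, ← pow_mul, ← Real.exp_nat_mul]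
    congr 1
    push_cast
    ring
  have h1 := Nat.lt_floor_add_one ((n : ℝ) ^ (0.05 : ℝ))
  have h2 : E ^ 2 ≤ √(2 * (⌊(n : ℝ) ^ (0.05 : ℝ)⌋₊ : ℝ) + 1) := by
    refine Real.le_sqrt_of_sq_le ?_
    rw [← hpow]
    have : (0 : ℝ) ≤ (⌊(n : ℝ) ^ (0.05 : ℝ)⌋₊ : ℝ) := Nat.cast_nonneg _
    linarith
  have hE0 : 0 < E := by linarith
  rw [Real.exp_neg, div_le_iff₀ (by linarith [pow_pos hE0 2]), ← div_eq_inv_mul,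
    le_div_iff₀ hE0]
  nlinarith

theorem le_logb_numPolyThreshold {n d : ℕ} (hd : 1 ≤ d) (hdn : (d : ℝ) ≤ (n : ℝ) ^ (0.9 : ℝ))
    (hL : 30000 < Real.log n) :
    (1 - 30000 / Real.log n) ^ d * ((n : ℝ) * binomSum n d) ≤
      Real.logb 2 (numPolyThreshold n d) := by
  have hL0 : 0 < Real.log n := by linarith
  have hn : (0 : ℝ) < n := lt_of_le_of_ne (Nat.cast_nonneg n) fun h0 => by simp [← h0] at hL0
  have hlogn : Real.log n ≤ n := (Real.log_le_sub_one_of_pos hn).trans (by linarith)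
  obtain ⟨a, ha⟩ : ∃ a, a = (n : ℝ) / Real.log n := ⟨_, rfl⟩
  have ha1 : 1 ≤ a := ha ▸ (one_le_div hL0).2 hlogn
  have han : a * 30000 ≤ n := by
    rw [ha, div_mul_eq_mul_div, div_le_iff₀ hL0]
    gcongr
  obtain ⟨s, hs⟩ : ∃ s, s = ⌊(n : ℝ) ^ (0.05 : ℝ)⌋₊ := ⟨_, rfl⟩
  -- Each new coordinate gains a factor exp(-log n / 80), so `r` of them gain at least exp(100n/80),
  -- which beats 2^m.
  obtain ⟨r, hr⟩ : ∃ r, r = ⌈100 * a⌉₊ := ⟨_, rfl⟩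
  have hr1 : 100 * a ≤ r := hr ▸ Nat.le_ceil _
  have hr2 : (r : ℝ) ≤ 101 * a := by
    have := Nat.ceil_lt_add_one (show 0 ≤ 100 * a by linarith)
    rw [← hr] at this
    linarith
  have hda : (d : ℝ) ≤ 10 * a := ha ▸ hdn.trans (rpow_nine_tenths_le hL0)
  have hrn : r ≤ n := by
    have : (r : ℝ) ≤ n := by linarith
    exact_mod_cast this
  obtain ⟨m, rfl⟩ : ∃ m, n = m + r := ⟨n - r, by omega⟩
  have hcast : ((m + r : ℕ) : ℝ) = m + r := Nat.cast_add m r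
  have hdm : d < m := by
    have : (d : ℝ) < m := by linarith
    exact_mod_cast this
  have hdm' : (d : ℝ) < m := by exact_mod_cast hdm
  have hsmall : (2 : ℝ) ^ m * (2 / √(2 * s + 1)) ^ r < 1 := by
    have h1 := two_div_sqrt_le_exp (n := m + r) (by linarith)
    rw [← hs] at h1
    have h2 : (2 : ℝ) ≤ Real.exp 1 := by linarith [Real.add_one_le_exp 1]
    calc (2 : ℝ) ^ m * (2 / √(2 * s + 1)) ^ r
        ≤ Real.exp 1 ^ m * Real.exp (-(Real.log (m + r : ℕ) / 80)) ^ r := by gcongr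
      _ = Real.exp (m - Real.log (m + r : ℕ) / 80 * r) := by
        rw [← Real.exp_nat_mul, ← Real.exp_nat_mul, ← Real.exp_add]
        ring_nf
      _ < 1 := by
        rw [Real.exp_lt_one_iff]
        have h3 : Real.log (m + r : ℕ) * a = (m + r : ℕ) := by
          rw [ha]; field_simp
        have h4 := mul_le_mul_of_nonneg_left hr1 hL0.le
        have hr0 : (0 : ℝ) ≤ r := Nat.cast_nonneg r
        linarith
  have hmain := binomSum_mul_le_logb hd hdm.le hsmall
  have hlogb : 6 * s * d * Real.logb 2 (m + 1) ≤ 19200 * a := by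
    have hr0 : (1 : ℝ) ≤ r := by linarith
    have hlb : Real.logb 2 ((m : ℝ) + 1) ≤ 2 * Real.log (m + r : ℕ) := by
      have h2 : (1 : ℝ) / 2 ≤ Real.log 2 := by linarith [Real.log_two_gt_d9]
      rw [Real.logb, div_le_iff₀ (by linarith)]
      have h5 : Real.log ((m : ℝ) + 1) ≤ Real.log (m + r : ℕ) :=
        Real.log_le_log (by positivity) (by linarith)
      nlinarith
    have hs1 : (s : ℝ) ≤ ((m + r : ℕ) : ℝ) ^ (0.05 : ℝ) := hs ▸ Nat.floor_le (by positivity)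
    have hlb0 : 0 ≤ Real.logb 2 ((m : ℝ) + 1) := Real.logb_nonneg (by norm_num) (by linarith)
    calc _ ≤ 6 * ((m + r : ℕ) : ℝ) ^ (0.05 : ℝ) * ((m + r : ℕ) : ℝ) ^ (0.9 : ℝ) *
          (2 * Real.log (m + r : ℕ)) := by gcongr
      _ = 12 * (((m + r : ℕ) : ℝ) ^ (0.05 : ℝ) * ((m + r : ℕ) : ℝ) ^ (0.9 : ℝ) *
          Real.log (m + r : ℕ)) := by ring
      _ ≤ 12 * (1600 * a) := by
          refine mul_le_mul_of_nonneg_left ?_ (by norm_num)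
          rw [ha]
          exact rpow_mul_rpow_mul_log_le hL0
      _ = _ := by ring
  set L := Real.log (m + r : ℕ)
  set D := (binomSum (m + r) d : ℝ)
  have hD0 : 0 ≤ D := Nat.cast_nonneg _
  have hbin := pow_mul_binomSum_le_binomSum (Nat.le_add_right m r) hdm
  -- One minus the ratio is r/(n-d), where r ≤ 101a and d is small compared with n.
  have hq : 1 - 202 / L ≤ ((m : ℝ) - d) / ((m + r : ℕ) - d) := by
    rw [le_div_iff₀ (by linarith), one_sub_mul]
    have h1 : 202 / L * ((m + r : ℕ) - d) = 202 * a - 202 / L * d := by rw [ha]; ring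
    have h2 : 202 / L ≤ 1 := (div_le_one hL0).2 (by linarith)
    have h3 : 202 / L * d ≤ 1 * d := by gcongr
    linarith
  -- 19400 covers the total loss r + d + 19200a ≤ (101 + 10 + 19200)a, and 202 + 19400 ≤ 30000.
  have hC : 1 - 30000 / L ≤ (1 - 202 / L) * (1 - 19400 / L) := by
    have h1 : 0 ≤ 1 / L := by positivity
    have h2 : ∀ c : ℝ, c / L = c * (1 / L) := fun c => by ring
    rw [h2, h2 202, h2 19400]
    nlinarith
  have hC0 : 0 ≤ 1 - 30000 / L := by
    rw [sub_nonneg, div_le_one hL0]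
    exact hL.le
  have h202 : 0 ≤ 1 - 202 / L := by
    rw [sub_nonneg, div_le_one hL0]
    linarith
  have h194 : 0 ≤ 1 - 19400 / L := by
    rw [sub_nonneg, div_le_one hL0]
    linarith
  have h194' : 1 - 19400 / L ≤ 1 := by
    have : 0 ≤ 19400 / L := by positivity
    linarith
  calc (1 - 30000 / L) ^ d * (((m + r : ℕ) : ℝ) * D)
      ≤ ((1 - 202 / L) * (1 - 19400 / L)) ^ d * (((m + r : ℕ) : ℝ) * D) := by gcongr
    _ = (1 - 202 / L) ^ d * D * ((1 - 19400 / L) ^ d * (m + r : ℕ)) := by rw [mul_pow]; ring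
    _ ≤ (((m : ℝ) - d) / ((m + r : ℕ) - d)) ^ d * D * ((1 - 19400 / L) ^ 1 * (m + r : ℕ)) := by
        have h1 := pow_le_pow_left₀ h202 hq d
        have h2 := pow_le_pow_of_le_one h194 h194' hd
        have h3 := (pow_nonneg h202 d).trans h1
        gcongr
    _ ≤ binomSum m d * ((1 - 19400 / L) * (m + r : ℕ)) := by
        rw [pow_one]
        gcongr
    _ = binomSum m d * ((m + r : ℕ) - 19400 * a) := by rw [ha]; ring
    _ ≤ binomSum m d * ((m : ℝ) - d - 6 * s * d * Real.logb 2 (m + 1)) := by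
        refine mul_le_mul_of_nonneg_left ?_ (Nat.cast_nonneg _)
        linarith
    _ ≤ _ := hmain

end Estimates

/-! ### The two bounds combined -/

theorem theorem1p1 :
    (∃ C : ℝ, 0 < C ∧ ∀ n d : ℕ, 2 ≤ n → 1 ≤ d → (d : ℝ) ≤ (n : ℝ) ^ (0.9 : ℝ) →
      (max 0 (1 - C / Real.log (n : ℝ))) ^ d * ((n : ℝ) * (binomSum n d : ℝ))
        ≤ Real.logb 2 (numPolyThreshold n d : ℝ)) ∧
    (∀ n d : ℕ, 1 ≤ d → d ≤ n →
      Real.logb 2 (numPolyThreshold n d : ℝ) ≤ (n : ℝ) * (binomSum n d : ℝ)) := by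
  refine ⟨⟨30000, by norm_num, fun n d hn hd hdn => ?_⟩, fun n d hd hdn => ?_⟩
  · have hL : 0 < Real.log n := Real.log_pos (by exact_mod_cast hn)
    -- For small `n` the maximum is 0, and `d ≥ 1` makes the left side vanish.
    rcases le_or_gt (Real.log n) 30000 with h | h
    · rw [max_eq_left (sub_nonpos.2 ((one_le_div hL).2 h)), zero_pow (by omega), zero_mul]
      exact div_nonneg (Real.log_natCast_nonneg _) (Real.log_nonneg (by norm_num))
    · rw [max_eq_right (sub_nonneg.2 ((div_le_one hL).2 h.le))]
      exact le_logb_numPolyThreshold hd hdn h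
  · rcases Nat.eq_zero_or_pos (numPolyThreshold n d) with h0 | hpos
    · rw [h0, Nat.cast_zero, Real.logb_zero]
      positivity
    · have h1 : (numPolyThreshold n d : ℝ) ≤ ((2 : ℝ) ^ n) ^ binomSum n d := by
        exact_mod_cast numPolyThreshold_le hd hdn
      have h2 := Real.logb_le_logb_of_le (b := 2) (by norm_num) (by exact_mod_cast hpos) h1
      rw [Real.logb_pow, Real.logb_pow, Real.logb_self_eq_one (by norm_num)] at h2
      linarith
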